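/- **Notation.** Let $\mathbf O=(m,n,p,q)$ with $0\le n\le p$, $0\le m\le q$, and $\mathbf P=(u,v,\mathbf c,\mathbf d,\mathbf C,\mathbf D)$ with $u\in\mathbb C$, $v>0$, $\mathbf c\in\mathbb C^p$, $\mathbf d\in\mathbb C^q$, $\mathbf C\in(0,\infty)^p$, $\mathbf D\in(0,\infty)^q$. Put $$\Phi(z)=\frac{\prod_{l=1}^m\Gamma(d_l-D_lz)\prod_{l=1}^n\Gamma(1-c_l+C_lz)}{\prod_{l=n+1}^p\Gamma(c_l-C_lz)\prod_{l=m+1}^q\Gamma(1-d_l+D_lz)},\qquad H[s,\mathbf O,\mathbf P]=\frac{u}{2\pi i}\int_{\operatorname{Re}z=\sigma}\Phi(z)(vs)^z\,dz\quad(s>0),$$ where the line $\operatorname{Re}z=\sigma$ is any one that has the poles of all $\Gamma(1-c_l+C_lz)$, $l\le n$, on its left and the poles of all $\Gamma(d_l-D_lz)$, $l\le m$, on its right. For $N\ge1$ such pairs $(\mathbf O_j,\mathbf P_j)$, with kernels $\Phi_j$ and first two parameters $u_j,v_j$, and for $\rho>0$, $\eta\ge0$, put $$H^{0,1}_{1,0}\left[\begin{matrix}(1-\eta,\mathbf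 1_N)\\ \textbf{---}\end{matrix}:\Big(\frac{\rho}{N},\mathbf O_j,\mathbf P_j\Big)_{1,N}\right]=\frac{u_1\cdots u_N}{(2\pi i)^N}\int\!\cdots\!\int\Gamma\Big(\eta+\sum_{j=1}^N\zeta_j\Big)\prod_{j=1}^N\Phi_j(\zeta_j)\Big(\frac{v_j\rho}{N}\Big)^{\zeta_j}d\zeta_1\cdots d\zeta_N$$ over any lines $\operatorname{Re}\zeta_j=\tau_j$ that separate the poles of each $\Phi_j$ as above and satisfy $\eta+\sum_j\tau_j>0$. **Theorem.** Suppose that each pair $(\mathbf O_j,\mathbf P_j)$ satisfies the convergence condition $\sum_{l\le n}C_l-\sum_{l>n}C_l+\sum_{l\le m}D_l-\sum_{l>m}D_l>0$. (a) If $\eta>0$ and each $(\mathbf O_j,\mathbf P_j)$ has its poles placed as for a moment generating function, i.e. $\operatorname{Re}c_l<1$ for $l\le n$ and $\operatorname{Re}d_l\ge0$ for $l\le m$, then suitable lines $\operatorname{Re}\zeta_j=\tau_j$ exist. (b) The integrals that define $H[s,\mathbf O_j,\mathbf P_j]$ (for $s>0$) and the multivariate function converge absolutely along all suitable lines. (c)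 Whenever suitable lines exist, and whichever are chosen for the univariate functions and for the multivariate function, $$H^{0,1}_{1,0}\left[\begin{matrix}(1-\eta,\mathbf 1_N)\\ \textbf{---}\end{matrix}:\Big(\frac{\rho}{N},\mathbf O_j,\mathbf P_j\Big)_{1,N}\right]\approx\Big(\frac QM\Big)^{\eta}\sum_{\ell=1}^M\ell^{\eta-1}e^{-\ell Q/M}\prod_{j=1}^NH\Big[\frac{\ell Q\rho}{MN},\mathbf O_j,\mathbf P_j\Big]\qquad(0\ll Q\ll M),$$ in the sense that for every $\varepsilon>0$ there is $K>0$ such that the two sides differ by less than $\varepsilon$ for all real $Q\ge K$ and all integers $M\ge KQ$. -/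

import Mathlib

open MeasureTheory

noncomputable section

/-- Order sequence `O = (m, n, p, q)` and parameter sequence `P = (u, v, c, d, C, D)` of a
univariate Fox `H` function. Indices are `0`-based: the entries of `c`, `C` with index `< n` and of
`d`, `D` with index `< m` are the ones whose Gamma factors stand in the numerator. -/
structure FoxParam where
  m : ℕ
  n : ℕ
  p : ℕ
  q : ℕ
  n_le : n ≤ p
  m_le : m ≤ q
  u : ℂ
  v : ℝ
  c : Fin p → ℂ
  d : Fin q → ℂ
  C : Fin p → ℝ
  D : Fin q → ℝ
  v_pos : 0 < v
  C_pos : ∀ l, 0 < C l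
  D_pos : ∀ l, 0 < D l

namespace FoxParam

/-- The Mellin-Barnes kernel `Φ`. (In Mathlib `Γ` is `0` at its poles and `x / 0 = 0`, so the
factors `1 / Γ` have their usual value `0` there.) -/
def kernel (P : FoxParam) (z : ℂ) : ℂ :=
  ((∏ l with (l : Fin P.q).val < P.m, Complex.Gamma (P.d l - P.D l * z)) *
    ∏ l with (l : Fin P.p).val < P.n, Complex.Gamma (1 - P.c l + P.C l * z)) /
  ((∏ l with P.n ≤ (l : Fin P.p).val, Complex.Gamma (P.c l - P.C l * z)) *
    ∏ l with P.m ≤ (l : Fin P.q).val, Complex.Gamma (1 - P.d l + P.D l * z))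

/-- The vertical line `Re z = τ` is a suitable contour: the poles of the `Γ (1 - c + C z)`, `l < n`,
lie to its left and the poles of the `Γ (d - D z)`, `l < m`, lie to its right. -/
def IsContour (P : FoxParam) (τ : ℝ) : Prop :=
  (∀ l : Fin P.p, l.val < P.n → 0 < (1 - P.c l + P.C l * (τ : ℂ)).re) ∧
  (∀ l : Fin P.q, l.val < P.m → 0 < (P.d l - P.D l * (τ : ℂ)).re)

/-- `∑_{l ≤ n} C_l - ∑_{l > n} C_l + ∑_{l ≤ m} D_l - ∑_{l > m} D_l`. Its positivity is the standard
condition for the convergence of the Mellin-Barnes integral at every positive argument. -/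
def excess (P : FoxParam) : ℝ :=
  (∑ l : Fin P.p, if l.val < P.n then P.C l else -P.C l) +
  ∑ l : Fin P.q, if l.val < P.m then P.D l else -P.D l

/-- Position of the poles for a moment generating function: those of the `Γ (1 - c + C z)` have
negative real part and those of the `Γ (d - D z)` have nonnegative real part. For the parameters
`(0, 1 - c - C)`, `1 - d - D` of the moment generating function of a Fox `H` density with parameters
`c`, `d`, `C`, `D` this says `c_l + C_l ≤ 1` for `l ≤ n` and `-d_l / D_l < 1` for `l ≤ m`. -/
def HasMGFPoles (P : FoxParam) : Prop :=
  (∀ l : Fin P.p, l.val < P.n → (P.c l).re < 1) ∧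
  (∀ l : Fin P.q, l.val < P.m → 0 ≤ (P.d l).re)

/-- The integrand `Φ(z) (v s) ^ z` at `z = τ + i y`. -/
def integrand (P : FoxParam) (τ s y : ℝ) : ℂ :=
  P.kernel (τ + y * Complex.I) * ((P.v * s : ℝ) : ℂ) ^ ((τ : ℂ) + y * Complex.I)

/-- The univariate Fox `H` function `H[s, O, P] = u / (2 π i) ∫_{Re z = τ} Φ(z) (v s) ^ z dz`,
with `z = τ + i y`, `dz = i dy`. -/
def foxH (P : FoxParam) (τ s : ℝ) : ℂ :=
  P.u / (2 * Real.pi) * ∫ y : ℝ, P.integrand τ s y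

end FoxParam

/-- The outer parameters `(a_j; A_j^(1), …, A_j^(N))_{1,p}`, `(b_j; B_j^(1), …, B_j^(N))_{1,q}` of a
Fox `H` function `H^{0,n}_{p,q}` of `N` variables. -/
structure OuterParam (N : ℕ) where
  n : ℕ
  p : ℕ
  q : ℕ
  n_le : n ≤ p
  a : Fin p → ℂ
  A : Fin p → Fin N → ℝ
  b : Fin q → ℂ
  B : Fin q → Fin N → ℝ

namespace OuterParam

variable {N : ℕ}

/-- The coupling kernel `Ψ`. -/
def kernel (R : OuterParam N) (ζ : Fin N → ℂ) : ℂ :=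
  (∏ j with (j : Fin R.p).val < R.n, Complex.Gamma (1 - R.a j + ∑ l, R.A j l * ζ l)) /
  ((∏ j with R.n ≤ (j : Fin R.p).val, Complex.Gamma (R.a j - ∑ l, R.A j l * ζ l)) *
    ∏ j, Complex.Gamma (1 - R.b j + ∑ l, R.B j l * ζ l))

/-- The vertical lines `Re ζ_j = τ_j` are suitable contours: each of them separates the poles of
the `j`-th inner kernel, and the poles of the numerator of `Ψ` lie to the left. -/
def IsContour (R : OuterParam N) (P : Fin N → FoxParam) (τ : Fin N → ℝ) : Prop :=
  (∀ j, (P j).IsContour (τ j)) ∧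
  ∀ j : Fin R.p, j.val < R.n → 0 < (1 - R.a j + ∑ l, R.A j l * (τ l : ℂ)).re

/-- The integrand `Ψ(ζ) ∏ Φ_j(ζ_j) (v_j s_j) ^ ζ_j` at `ζ_j = τ_j + i y_j`. -/
def integrand (R : OuterParam N) (P : Fin N → FoxParam) (τ s y : Fin N → ℝ) : ℂ :=
  R.kernel (fun j => τ j + y j * Complex.I) * ∏ j, (P j).integrand (τ j) (s j) (y j)

/-- The Fox `H` function of `N` variables `H^{0,n}_{p,q}[(a; A), (b; B) : (s_j, O_j, P_j)_{1,N}]`,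
as an `N`-fold Mellin-Barnes integral along the lines `Re ζ_j = τ_j`; as in one variable,
`ζ_j = τ_j + i y_j`, `dζ_j = i dy_j`. -/
def foxH (R : OuterParam N) (P : Fin N → FoxParam) (τ s : Fin N → ℝ) : ℂ :=
  (∏ j, (P j).u) / (2 * Real.pi) ^ N * ∫ y : Fin N → ℝ, R.integrand P τ s y

/-- The outer parameters of `H^{0,1}_{1,0}[(1 - η, 1_N); - : …]`. -/
def special (N : ℕ) (η : ℝ) : OuterParam N where
  n := 1
  p := 1
  q := 0
  n_le := le_rfl
  a := fun _ => 1 - (η : ℂ)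
  A := fun _ _ => 1
  b := fun j => j.elim0
  B := fun j => j.elim0

end OuterParam

end

/-! Put `w = η + ∑ ζ_j` and `h = Q/M`. The coupling factor `Γ(w)` is Euler's integral of `t^(w-1)
e^(-t)`, and its right-endpoint Riemann sum of step `h` over `(0, Q]` is `gammaSum`. At each node `t
= ℓh` the power `t^(w-1)` factors over the `ζ_j`, so replacing `Γ(w)` by the sum splits the `N`-fold
integral into products of univariate functions: this is exactly the right-hand side
(`sum_prod_foxH_eq_integral`). The limit uses dominated convergence twice: in `t`, where the sums
tend to `Γ(w)` (`tendsto_gammaSum`), and in the imaginary parts of the `ζ_j`, where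
`norm_gammaSum_le` gives a bound depending only on `re w`, which is constant along the contours.
Integrability rests on exponential decay of the kernels (`verticalDecay_kernel`). Instead of
Stirling's formula, Gamma is compared along horizontal lines with its values on `re z = 1/2`, which
the reflection formula gives exactly. The same decay and Cauchy's theorem make the univariate
functions independent of the contour (`FoxParam.foxH_eq`). -/

open Filter Topology

/-! ### Gamma on vertical lines: comparison with `re z = 1/2` -/

namespace Complex

lemma norm_betaIntegral_le {u v : ℂ} (hu : 0 < u.re) (hv : 0 < v.re) :
    ‖betaIntegral u v‖ * Real.Gamma (u.re + v.re) ≤ Real.Gamma u.re * Real.Gamma v.re := by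
  have hB : ((∫ x in (0 : ℝ)..1, ‖(x : ℂ) ^ (u - 1) * (1 - (x : ℂ)) ^ (v - 1)‖ : ℝ) : ℂ) =
      betaIntegral (u.re : ℂ) (v.re : ℂ) := by
    rw [betaIntegral, ← intervalIntegral.integral_ofReal]
    refine intervalIntegral.integral_congr_ae ?_
    -- At `x = 1` the base `1 - x` vanishes and the norm formula for positive bases is unavailable.
    have h1 : ∀ᵐ x : ℝ, x ≠ 1 := by
      simp [ae_iff]
    filter_upwards [h1] with x hx1 hx
    rw [Set.uIoc_of_le zero_le_one] at hx
    have hx0 : 0 < x := hx.1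
    have hx1' : 0 < 1 - x := sub_pos.2 (lt_of_le_of_ne hx.2 hx1)
    have e : (1 - (x : ℂ)) = ((1 - x : ℝ) : ℂ) := by push_cast; ring
    rw [e, norm_mul, norm_cpow_eq_rpow_re_of_pos hx0, norm_cpow_eq_rpow_re_of_pos hx1']
    push_cast
    rw [ofReal_cpow hx0.le, ofReal_cpow hx1'.le]
    simp
  have hG := Gamma_mul_Gamma_eq_betaIntegral (s := (u.re : ℂ)) (t := (v.re : ℂ))
    (by simpa using hu) (by simpa using hv)
  rw [← hB, ← ofReal_add, Gamma_ofReal, Gamma_ofReal, Gamma_ofReal] at hG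
  have hG' : Real.Gamma u.re * Real.Gamma v.re = Real.Gamma (u.re + v.re) *
      ∫ x in (0 : ℝ)..1, ‖(x : ℂ) ^ (u - 1) * (1 - (x : ℂ)) ^ (v - 1)‖ := by
    exact_mod_cast hG
  rw [hG', mul_comm]
  refine mul_le_mul_of_nonneg_left ?_ (Real.Gamma_pos_of_pos (add_pos hu hv)).le
  exact intervalIntegral.norm_integral_le_integral_norm zero_le_one

/-- On a horizontal line in the right half plane `‖Γ z‖ / Γ (re z)` is nondecreasing. -/
lemma norm_Gamma_mul_Gamma_add_le {z : ℂ} (hz : 0 < z.re) {s : ℝ} (hs : 0 ≤ s) :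
    ‖Gamma z‖ * Real.Gamma (z.re + s) ≤ ‖Gamma (z + s)‖ * Real.Gamma z.re := by
  rcases hs.eq_or_lt with rfl | hs
  · simp
  have h := Gamma_mul_Gamma_eq_betaIntegral (s := z) (t := (s : ℂ)) hz (by simpa using hs)
  have hn := congrArg norm h
  have hGs := Real.Gamma_pos_of_pos hs
  rw [norm_mul, norm_mul, Gamma_ofReal, norm_real, Real.norm_of_nonneg hGs.le] at hn
  have hb := norm_betaIntegral_le (u := z) (v := (s : ℂ)) hz (by simpa using hs)
  rw [ofReal_re] at hb
  refine le_of_mul_le_mul_right ?_ hGs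
  calc ‖Gamma z‖ * Real.Gamma (z.re + s) * Real.Gamma s
      = ‖Gamma (z + s)‖ * (‖betaIntegral z s‖ * Real.Gamma (z.re + s)) := by
        rw [mul_right_comm, hn]; ring
    _ ≤ ‖Gamma (z + s)‖ * (Real.Gamma z.re * Real.Gamma s) := by gcongr
    _ = _ := by ring

/-- On this line `1 - z` is the conjugate of `z`, so the reflection formula computes `Γ(z)` times
its conjugate. -/
lemma norm_Gamma_half_add_sq (y : ℝ) :
    ‖Gamma (1 / 2 + y * I)‖ ^ 2 = Real.pi / Real.cosh (Real.pi * y) := by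
  have h := Gamma_mul_Gamma_one_sub (1 / 2 + y * I)
  have e : (1 : ℂ) - (1 / 2 + y * I) = (starRingEnd ℂ) (1 / 2 + y * I) := by
    simp only [map_add, map_mul, conj_ofReal, conj_I, map_div₀, map_one, map_ofNat]
    ring_nf
  have e2 : sin (Real.pi * (1 / 2 + y * I)) = Real.cosh (Real.pi * y) := by
    rw [show (Real.pi : ℂ) * (1 / 2 + y * I) = (Real.pi * y : ℂ) * I + Real.pi / 2 by ring,
      sin_add_pi_div_two, cos_mul_I]
    push_cast; rfl
  rw [e, Gamma_conj, mul_conj, e2, normSq_eq_norm_sq] at h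
  exact_mod_cast h

lemma exp_abs_le_two_mul_cosh (x : ℝ) : Real.exp |x| ≤ 2 * Real.cosh x := by
  rw [← Real.cosh_abs, Real.cosh_eq]
  have := Real.exp_pos (-|x|)
  linarith

lemma cosh_le_exp_abs (x : ℝ) : Real.cosh x ≤ Real.exp |x| := by
  rw [← Real.cosh_abs, Real.cosh_eq]
  have : Real.exp (-|x|) ≤ Real.exp |x| := Real.exp_le_exp.2 (by linarith [abs_nonneg x])
  linarith

lemma norm_Gamma_half_add_le (y : ℝ) :
    ‖Gamma (1 / 2 + y * I)‖ ≤ 3 * Real.exp (-(Real.pi / 2) * |y|) := by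
  refine le_of_sq_le_sq ?_ (by positivity)
  rw [norm_Gamma_half_add_sq, div_le_iff₀ (Real.cosh_pos _), mul_pow, ← Real.exp_nat_mul]
  have h := exp_abs_le_two_mul_cosh (Real.pi * y)
  rw [abs_mul, abs_of_pos Real.pi_pos] at h
  have e : ((2 : ℕ) : ℝ) * (-(Real.pi / 2) * |y|) = -(Real.pi * |y|) := by push_cast; ring
  rw [e]
  -- The constant 3 suffices because `4 * 2 ≤ 3 ^ 2`.
  calc Real.pi ≤ 4 := Real.pi_le_four
    _ = 4 * (Real.exp (-(Real.pi * |y|)) * Real.exp (Real.pi * |y|)) := by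
        rw [← Real.exp_add]; simp
    _ ≤ 4 * (Real.exp (-(Real.pi * |y|)) * (2 * Real.cosh (Real.pi * y))) := by gcongr
    _ ≤ _ := by
        have : 0 < Real.exp (-(Real.pi * |y|)) * Real.cosh (Real.pi * y) :=
          mul_pos (Real.exp_pos _) (Real.cosh_pos _)
        nlinarith

lemma exp_le_norm_Gamma_half_add (y : ℝ) :
    Real.exp (-(Real.pi / 2) * |y|) ≤ ‖Gamma (1 / 2 + y * I)‖ := by
  refine le_of_sq_le_sq ?_ (norm_nonneg _)
  rw [norm_Gamma_half_add_sq, le_div_iff₀ (Real.cosh_pos _), ← Real.exp_nat_mul]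
  have h := cosh_le_exp_abs (Real.pi * y)
  rw [abs_mul, abs_of_pos Real.pi_pos] at h
  have e : ((2 : ℕ) : ℝ) * (-(Real.pi / 2) * |y|) = -(Real.pi * |y|) := by push_cast; ring
  rw [e]
  calc _ ≤ Real.exp (-(Real.pi * |y|)) * Real.exp (Real.pi * |y|) := by gcongr
    _ = 1 := by rw [← Real.exp_add]; simp
    _ ≤ Real.pi := by linarith [Real.pi_gt_three]

/-- Iterates `1/Γ(z) = z/Γ(z+1)`. Working with the entire function `1/Γ` avoids excluding poles. -/
lemma norm_inv_Gamma_le_pow_mul (z : ℂ) (n : ℕ) :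
    ‖(Gamma z)⁻¹‖ ≤ (‖z‖ + n) ^ n * ‖(Gamma (z + n))⁻¹‖ := by
  induction n with
  | zero => simp
  | succ n ih =>
    rw [one_div_Gamma_eq_self_mul_one_div_Gamma_add_one (z + n), norm_mul] at ih
    have h1 : ‖z + n‖ ≤ ‖z‖ + (n + 1) := by
      refine (norm_add_le _ _).trans ?_
      simp
    push_cast
    rw [← add_assoc]
    calc _ ≤ _ := ih
      _ ≤ (‖z‖ + (n + 1)) ^ n * ((‖z‖ + (n + 1)) * ‖(Gamma (z + n + 1))⁻¹‖) := by
        gcongr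
        linarith
      _ = _ := by ring

lemma norm_Gamma_add_nat_le {z : ℂ} (hz : 0 < z.re) (n : ℕ) :
    ‖Gamma (z + n)‖ ≤ (‖z‖ + n) ^ n * ‖Gamma z‖ := by
  have h := norm_inv_Gamma_le_pow_mul z n
  have h1 : 0 < ‖Gamma z‖ := norm_pos_iff.2 (Gamma_ne_zero_of_re_pos hz)
  have h2 : 0 < ‖Gamma (z + n)‖ := norm_pos_iff.2 (Gamma_ne_zero_of_re_pos (by
    simp only [add_re, natCast_re]; positivity))
  rw [norm_inv, norm_inv, ← div_eq_mul_inv, inv_eq_one_div, div_le_div_iff₀ h1 h2] at h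
  simpa using h

end Complex

/-! ### Exponential decay in vertical strips -/

/-- `f z` is bounded by a polynomial in `|im z|` times `exp (-α |im z|)`, uniformly in the strip
`a ≤ re z ≤ b`. -/
def VerticalDecay (f : ℂ → ℂ) (a b α : ℝ) : Prop :=
  ∃ (K : ℝ) (n : ℕ), 0 ≤ K ∧ ∀ z : ℂ, a ≤ z.re → z.re ≤ b →
    ‖f z‖ ≤ K * (1 + |z.im|) ^ n * Real.exp (-α * |z.im|)

lemma VerticalDecay.mul {f g : ℂ → ℂ} {a b α β : ℝ} (hf : VerticalDecay f a b α)
    (hg : VerticalDecay g a b β) : VerticalDecay (fun z => f z * g z) a b (α + β) := by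
  obtain ⟨K, n, hK, hf⟩ := hf
  obtain ⟨L, m, hL, hg⟩ := hg
  refine ⟨K * L, n + m, by positivity, fun z ha hb => ?_⟩
  rw [norm_mul]
  calc _ ≤ (K * (1 + |z.im|) ^ n * Real.exp (-α * |z.im|)) *
        (L * (1 + |z.im|) ^ m * Real.exp (-β * |z.im|)) :=
        mul_le_mul (hf z ha hb) (hg z ha hb) (norm_nonneg _) (by positivity)
    _ = K * L * (1 + |z.im|) ^ (n + m) *
        (Real.exp (-α * |z.im|) * Real.exp (-β * |z.im|)) := by ring
    _ = _ := by rw [← Real.exp_add]; ring_nf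

lemma VerticalDecay.prod {ι : Type*} {s : Finset ι} {f : ι → ℂ → ℂ} {a b : ℝ} {α : ι → ℝ}
    (hf : ∀ i ∈ s, VerticalDecay (f i) a b (α i)) :
    VerticalDecay (fun z => ∏ i ∈ s, f i z) a b (∑ i ∈ s, α i) := by
  classical
  induction s using Finset.induction_on with
  | empty => exact ⟨1, 0, zero_le_one, fun z _ _ => by simp⟩
  | insert i s hi ih =>
    simp only [Finset.prod_insert hi, Finset.sum_insert hi]
    exact (hf i (Finset.mem_insert_self i s)).mul
      (ih fun j hj => hf j (Finset.mem_insert_of_mem hj))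

/-- The exponential beats the polynomial, by one term of the series of `exp (α (1 + |im z|))`. This
form gives both integrability on lines and vanishing of horizontal sides of rectangles. -/
lemma VerticalDecay.exists_le_inv_one_add_sq {f : ℂ → ℂ} {a b α : ℝ}
    (hf : VerticalDecay f a b α) (hα : 0 < α) :
    ∃ K : ℝ, ∀ z : ℂ, a ≤ z.re → z.re ≤ b → ‖f z‖ ≤ K * (1 + z.im ^ 2)⁻¹ := by
  obtain ⟨K, n, hK, hf⟩ := hf
  refine ⟨K * ((n + 2).factorial * Real.exp α / α ^ (n + 2)), fun z ha hb => (hf z ha hb).trans ?_⟩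
  rw [← div_eq_mul_inv, le_div_iff₀ (by positivity), mul_assoc, mul_assoc]
  refine mul_le_mul_of_nonneg_left ?_ hK
  set t := |z.im|
  have ht : 0 ≤ t := abs_nonneg _
  have h := Real.pow_div_factorial_le_exp (α * (1 + t)) (by positivity) (n + 2)
  rw [div_le_iff₀ (by positivity), mul_pow] at h
  rw [le_div_iff₀ (by positivity)]
  have h2 : 1 + z.im ^ 2 ≤ (1 + t) ^ 2 := by
    rw [← sq_abs]; nlinarith
  calc (1 + t) ^ n * (Real.exp (-α * t) * (1 + z.im ^ 2)) * α ^ (n + 2)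
      ≤ (1 + t) ^ n * (Real.exp (-α * t) * (1 + t) ^ 2) * α ^ (n + 2) := by gcongr
    _ = (α ^ (n + 2) * (1 + t) ^ (n + 2)) * Real.exp (-α * t) := by ring
    _ ≤ (Real.exp (α * (1 + t)) * (n + 2).factorial) * Real.exp (-α * t) := by gcongr
    _ = (n + 2).factorial * (Real.exp (α * (1 + t)) * Real.exp (-α * t)) := by ring
    _ = _ := by rw [← Real.exp_add]; ring_nf

/-- Decay is preserved by a real affine change of variable. -/
lemma VerticalDecay.comp_affine {f : ℂ → ℂ} {a b a' b' α : ℝ} (w : ℂ) (r : ℝ)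
    (hf : VerticalDecay f a' b' α)
    (hab : ∀ x, a ≤ x → x ≤ b → a' ≤ w.re + r * x ∧ w.re + r * x ≤ b') :
    VerticalDecay (fun z => f (w + r * z)) a b (α * |r|) := by
  obtain ⟨K, n, hK, hf⟩ := hf
  -- The exponential factor pays for the shift by `w.im`; `|α|` is needed because the rate is
  -- negative for reciprocals of Gamma.
  refine ⟨K * (1 + |w.im| + |r|) ^ n * Real.exp (|α| * |w.im|), n, by positivity,
    fun z ha hb => ?_⟩
  have hre : (w + r * z).re = w.re + r * z.re := by simp
  have him : (w + r * z).im = w.im + r * z.im := by simp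
  obtain ⟨h1, h2⟩ := hab z.re ha hb
  refine (hf _ (hre ▸ h1) (hre ▸ h2)).trans ?_
  rw [him]
  have hw := abs_nonneg w.im
  have hr := abs_nonneg r
  have hz := abs_nonneg z.im
  have hup : |w.im + r * z.im| ≤ |w.im| + |r| * |z.im| := by
    rw [← abs_mul]; exact abs_add_le _ _
  have hlo : |r| * |z.im| - |w.im| ≤ |w.im + r * z.im| := by
    rw [← abs_mul]
    have := abs_sub_abs_le_abs_sub (r * z.im) (-w.im)
    rw [abs_neg, sub_neg_eq_add, add_comm (r * z.im)] at this
    exact this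
  have hexp : -α * |w.im + r * z.im| ≤ |α| * |w.im| + -(α * |r|) * |z.im| := by
    have : -α * (|w.im + r * z.im| - |r| * |z.im|) ≤ |α| * |w.im| := by
      refine (le_abs_self _).trans ?_
      rw [abs_mul, abs_neg]
      refine mul_le_mul_of_nonneg_left ?_ (abs_nonneg _)
      rw [abs_le]
      constructor <;> linarith
    linarith
  have hpoly : 1 + |w.im + r * z.im| ≤ (1 + |w.im| + |r|) * (1 + |z.im|) := by
    nlinarith [mul_nonneg hw hz]
  calc K * (1 + |w.im + r * z.im|) ^ n * Real.exp (-α * |w.im + r * z.im|)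
      ≤ K * ((1 + |w.im| + |r|) * (1 + |z.im|)) ^ n *
        Real.exp (|α| * |w.im| + -(α * |r|) * |z.im|) := by
        gcongr
    _ = _ := by rw [Real.exp_add, mul_pow]; ring

/-- Moving right to `re z = 1/2 + n` costs a bounded factor, by monotonicity of `‖Γ z‖ / Γ (re z)`;
returning to `re z = 1/2` by the functional equation costs a polynomial. -/
lemma verticalDecay_Gamma {a b : ℝ} (ha : 0 < a) :
    VerticalDecay Complex.Gamma a b (Real.pi / 2) := by
  obtain ⟨n, hn⟩ := exists_nat_ge (b - 1 / 2)
  have hcont : ContinuousOn Real.Gamma (Set.Icc a b) := fun x hx =>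
    (Real.differentiableAt_Gamma fun m => by
      have := hx.1
      have hm : (0 : ℝ) ≤ m := m.cast_nonneg
      linarith).continuousAt.continuousWithinAt
  obtain ⟨B, hB⟩ := isCompact_Icc.exists_bound_of_continuousOn hcont
  have hG : 0 < Real.Gamma (1 / 2 + n) := Real.Gamma_pos_of_pos (by positivity)
  refine ⟨3 * |B| * (1 + n) ^ n / Real.Gamma (1 / 2 + n), n, by positivity, fun z hza hzb => ?_⟩
  have hz : 0 < z.re := ha.trans_le hza
  have h1 := Complex.norm_Gamma_mul_Gamma_add_le hz (s := 1 / 2 + n - z.re) (by linarith)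
  have e1 : z.re + (1 / 2 + n - z.re) = 1 / 2 + n := by ring
  have e2 : z + ((1 / 2 + n - z.re : ℝ) : ℂ) = (1 / 2 + z.im * Complex.I) + n := by
    apply Complex.ext <;> simp
  rw [e1, e2] at h1
  have h2 := Complex.norm_Gamma_add_nat_le (z := 1 / 2 + z.im * Complex.I) (by simp) n
  have h3 : ‖(1 / 2 + z.im * Complex.I : ℂ)‖ ≤ 1 + |z.im| := by
    refine (norm_add_le _ _).trans ?_
    simp
    norm_num
  have h4 := Complex.norm_Gamma_half_add_le z.im
  have h5 : Real.Gamma z.re ≤ |B| :=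
    (le_abs_self _).trans ((hB _ ⟨hza, hzb⟩).trans (le_abs_self _))
  rw [div_mul_eq_mul_div, div_mul_eq_mul_div, le_div_iff₀ hG]
  have h6 : ‖(1 / 2 + z.im * Complex.I : ℂ)‖ + n ≤ (1 + n) * (1 + |z.im|) := by
    nlinarith [abs_nonneg z.im, (n.cast_nonneg : (0 : ℝ) ≤ n),
      mul_nonneg (n.cast_nonneg : (0 : ℝ) ≤ n) (abs_nonneg z.im)]
  calc _ ≤ _ := h1
    _ ≤ ((‖(1 / 2 + z.im * Complex.I : ℂ)‖ + n) ^ n * ‖Complex.Gamma (1 / 2 + z.im * Complex.I)‖) *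
        |B| := by gcongr
    _ ≤ (((1 + n) * (1 + |z.im|)) ^ n * (3 * Real.exp (-(Real.pi / 2) * |z.im|))) * |B| := by
        gcongr
    _ = _ := by rw [mul_pow]; ring

/-- The functional equation moves `z` to `re z ≥ 1/2` at polynomial cost, and there monotonicity
from the line `1/2` bounds `‖Γ‖` below. Poles do not matter, so the strip is arbitrary. -/
lemma verticalDecay_inv_Gamma (a b : ℝ) :
    VerticalDecay (fun z => (Complex.Gamma z)⁻¹) a b (-(Real.pi / 2)) := by
  obtain ⟨n, hn⟩ := exists_nat_ge (1 / 2 - a)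
  have hpos : ∀ x ∈ Set.Icc a b, 0 < Real.Gamma (x + n) := fun x hx =>
    Real.Gamma_pos_of_pos (by linarith [hx.1])
  have hcont : ContinuousOn (fun x => (Real.Gamma (x + n))⁻¹) (Set.Icc a b) := by
    refine ContinuousOn.inv₀ (fun x hx => ?_) fun x hx => (hpos x hx).ne'
    refine ContinuousAt.continuousWithinAt ?_
    refine ContinuousAt.comp (g := Real.Gamma) (f := fun x : ℝ => x + n) ?_ (by fun_prop)
    refine (Real.differentiableAt_Gamma fun m => ?_).continuousAt
    have hm : (0 : ℝ) ≤ m := m.cast_nonneg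
    linarith [hx.1]
  obtain ⟨B, hB⟩ := isCompact_Icc.exists_bound_of_continuousOn hcont
  have hG : 0 < Real.Gamma (1 / 2) := Real.Gamma_pos_of_pos (by positivity)
  refine ⟨(1 + |a| + |b| + n) ^ n * |B| * Real.Gamma (1 / 2), n, by positivity,
    fun z hza hzb => ?_⟩
  have h1 := Complex.norm_Gamma_mul_Gamma_add_le (z := 1 / 2 + z.im * Complex.I) (by simp)
    (s := z.re + n - 1 / 2) (by linarith)
  have e1 : (1 / 2 + z.im * Complex.I : ℂ).re = 1 / 2 := by simp
  have e2 : (1 / 2 + z.im * Complex.I : ℂ) + ((z.re + n - 1 / 2 : ℝ) : ℂ) = z + n := by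
    conv_rhs => rw [← Complex.re_add_im z]
    push_cast
    ring
  rw [e1, e2, show (1 / 2 : ℝ) + (z.re + n - 1 / 2) = z.re + n by ring] at h1
  have h2 := Complex.exp_le_norm_Gamma_half_add z.im
  have hp := hpos _ ⟨hza, hzb⟩
  have h3 : (Real.Gamma (z.re + n))⁻¹ ≤ |B| :=
    (le_abs_self _).trans ((hB _ ⟨hza, hzb⟩).trans (le_abs_self _))
  have hzn : 0 < ‖Complex.Gamma (z + n)‖ := norm_pos_iff.2 <|
    Complex.Gamma_ne_zero_of_re_pos (by simp; linarith)
  have h4 : ‖(Complex.Gamma (z + n))⁻¹‖ ≤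
      |B| * Real.Gamma (1 / 2) * Real.exp (Real.pi / 2 * |z.im|) := by
    rw [norm_inv, inv_le_iff_one_le_mul₀ hzn]
    calc 1 = (Real.exp (-(Real.pi / 2) * |z.im|) * Real.Gamma (z.re + n)) *
          ((Real.Gamma (z.re + n))⁻¹ * Real.exp (Real.pi / 2 * |z.im|)) := by
          have : Real.exp (-(Real.pi / 2) * |z.im|) * Real.exp (Real.pi / 2 * |z.im|) = 1 := by
            rw [← Real.exp_add]; simp
          field_simp
          rw [← this]; ring_nf
      _ ≤ (‖Complex.Gamma (z + n)‖ * Real.Gamma (1 / 2)) *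
          (|B| * Real.exp (Real.pi / 2 * |z.im|)) := by
          refine mul_le_mul ((mul_le_mul_of_nonneg_right h2 hp.le).trans h1)
            (mul_le_mul_of_nonneg_right h3 (Real.exp_pos _).le) ?_ ?_ <;> positivity
      _ = _ := by ring
  have h5 : ‖z‖ + n ≤ (1 + |a| + |b| + n) * (1 + |z.im|) := by
    have hz : ‖z‖ ≤ |z.re| + |z.im| := Complex.norm_le_abs_re_add_abs_im z
    have hr : |z.re| ≤ |a| + |b| := by
      rw [abs_le]
      constructor <;> linarith [neg_abs_le a, le_abs_self b, abs_nonneg a, abs_nonneg b]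
    have : 0 ≤ (|a| + |b| + n) * |z.im| := by positivity
    nlinarith
  calc _ ≤ _ := Complex.norm_inv_Gamma_le_pow_mul z n
    _ ≤ ((1 + |a| + |b| + n) * (1 + |z.im|)) ^ n *
        (|B| * Real.Gamma (1 / 2) * Real.exp (Real.pi / 2 * |z.im|)) := by gcongr
    _ = _ := by rw [mul_pow, neg_neg]; ring

/-! ### Riemann sums for Euler's integral -/

/-- A sum over `1 ≤ l ≤ M` of values at multiples of `h` as the integral of a step function. -/
lemma sum_mul_eq_integral_ceil (G : ℝ → ℂ) {h : ℝ} (hh : 0 < h) (M : ℕ) :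
    ∑ l ∈ Finset.Icc 1 M, (h : ℂ) * G (l * h) =
      ∫ t in Set.Ioi (0 : ℝ), (Set.Iic (M * h)).indicator (fun t => G (⌈t / h⌉₊ * h)) t := by
  have key : ∀ k : ℕ, Set.EqOn (fun t => G (⌈t / h⌉₊ * h)) (fun _ => G (((k + 1 : ℕ) : ℝ) * h))
      (Set.uIoc ((k : ℝ) * h) (((k + 1 : ℕ) : ℝ) * h)) := by
    intro k t ht
    rw [Set.uIoc_of_le (by gcongr; simp)] at ht
    have : ⌈t / h⌉₊ = k + 1 := by
      rw [Nat.ceil_eq_iff (by simp)]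
      refine ⟨?_, ?_⟩
      · rw [lt_div_iff₀ hh]; simpa using ht.1
      · rw [div_le_iff₀ hh]; exact ht.2
    simp only [this]
  have hsum := intervalIntegral.sum_integral_adjacent_intervals (μ := volume)
    (f := fun t => G (⌈t / h⌉₊ * h)) (a := fun k : ℕ => (k : ℝ) * h) (n := M) (fun k _ => by
      exact (intervalIntegrable_congr (key k)).2 (by simp))
  have hterm : ∀ k : ℕ, ∫ t in ((k : ℝ) * h)..(((k + 1 : ℕ) : ℝ) * h), G (⌈t / h⌉₊ * h) =
      h * G (((k + 1 : ℕ) : ℝ) * h) := by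
    intro k
    rw [intervalIntegral.integral_congr_ae (ae_of_all _ fun t ht => key k ht)]
    rw [intervalIntegral.integral_const]
    rw [Complex.real_smul]
    push_cast
    ring
  simp only [hterm] at hsum
  -- The cell `(kh, (k+1)h]` is sampled at its right end, hence the shift of the index by one.
  rw [Finset.range_eq_Ico, Finset.sum_Ico_add' (fun k : ℕ => (h : ℂ) * G ((k : ℝ) * h)) 0 M 1] at hsum
  rw [setIntegral_indicator measurableSet_Iic, Set.Ioi_inter_Iic]
  rw [intervalIntegral.integral_of_le (by simp; positivity)] at hsum
  simpa [Finset.Ico_add_one_right_eq_Icc] using hsum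

/-- The power is monotone or antitone according to the sign of `x`; adding both endpoint values
covers both cases and frees the majorant of the step size. -/
lemma rpow_le_rpow_add_rpow {t T : ℝ} (x : ℝ) (ht : 0 < t) (h1 : t ≤ T) (h2 : T ≤ t + 1) :
    T ^ x ≤ t ^ x + (t + 1) ^ x := by
  rcases le_total 0 x with hx | hx
  · have := Real.rpow_le_rpow (by linarith) h2 hx
    have := Real.rpow_nonneg ht.le x
    linarith
  · have := Real.rpow_le_rpow_of_nonpos ht h1 hx
    have := Real.rpow_nonneg (by linarith : 0 ≤ t + 1) x
    linarith

lemma integrableOn_rpow_add_rpow_mul_exp {x : ℝ} (hx : 0 < x) :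
    IntegrableOn (fun t : ℝ => (t ^ (x - 1) + (t + 1) ^ (x - 1)) * Real.exp (-t)) (Set.Ioi 0) := by
  have h1 := Real.GammaIntegral_convergent hx
  have h2 : IntegrableOn (fun t : ℝ => Real.exp (-(t + 1)) * (t + 1) ^ (x - 1)) (Set.Ioi 0) := by
    have h3 : IntegrableOn (fun t : ℝ => Real.exp (-t) * t ^ (x - 1))
        ((fun t : ℝ => t + 1) '' Set.Ioi 0) :=
      h1.mono_set (by rintro _ ⟨t, ht, rfl⟩; exact add_pos (Set.mem_Ioi.1 ht) one_pos)
    exact ((measurePreserving_add_right volume (1 : ℝ)).integrableOn_image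
      (measurableEmbedding_addRight 1)).1 h3
  refine (h1.add (h2.const_mul (Real.exp 1))).congr_fun (fun t _ => ?_) measurableSet_Ioi
  simp only [Pi.add_apply]
  have : Real.exp (-t) = Real.exp 1 * Real.exp (-(t + 1)) := by
    rw [← Real.exp_add]; ring_nf
  rw [← mul_assoc, ← this]
  ring

/-- The Riemann sum with step `h` of `t ^ (w - 1) e ^ (-t)` over `(0, M h]`. -/
noncomputable def gammaSum (h : ℝ) (M : ℕ) (w : ℂ) : ℂ :=
  ∑ l ∈ Finset.Icc 1 M, (h : ℂ) * (((l * h : ℝ) : ℂ) ^ (w - 1) * Real.exp (-(l * h)))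

/-- The step function on `(0, M h]` whose integral is `gammaSum h M w`. -/
noncomputable def gammaStep (h : ℝ) (M : ℕ) (w : ℂ) : ℝ → ℂ :=
  (Set.Iic (M * h)).indicator
    (fun t => ((⌈t / h⌉₊ * h : ℝ) : ℂ) ^ (w - 1) * Real.exp (-(⌈t / h⌉₊ * h)))

lemma gammaSum_eq_integral {h : ℝ} (hh : 0 < h) (M : ℕ) (w : ℂ) :
    gammaSum h M w = ∫ t in Set.Ioi (0 : ℝ), gammaStep h M w t :=
  sum_mul_eq_integral_ceil (fun T => (T : ℂ) ^ (w - 1) * Real.exp (-T)) hh M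

lemma le_ceil_div_mul {h : ℝ} (hh : 0 < h) (t : ℝ) : t ≤ ⌈t / h⌉₊ * h := by
  rw [← div_le_iff₀ hh]; exact Nat.le_ceil _

lemma ceil_div_mul_le {h t : ℝ} (hh : 0 < h) (ht : 0 < t) : ⌈t / h⌉₊ * h ≤ t + h := by
  have := (Nat.ceil_lt_add_one (div_pos ht hh).le).le
  calc _ ≤ (t / h + 1) * h := by gcongr
    _ = t + h := by field_simp

lemma norm_gammaStep_le {h : ℝ} (hh : 0 < h) (h1 : h ≤ 1) (M : ℕ) (w : ℂ) {t : ℝ} (ht : 0 < t) :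
    ‖gammaStep h M w t‖ ≤ (t ^ (w.re - 1) + (t + 1) ^ (w.re - 1)) * Real.exp (-t) := by
  refine (norm_indicator_le_norm_self _ _).trans ?_
  have hT := le_ceil_div_mul hh t
  have hT' := (ceil_div_mul_le hh ht).trans (by linarith : t + h ≤ t + 1)
  rw [norm_mul, Complex.norm_cpow_eq_rpow_re_of_pos (ht.trans_le hT), Complex.norm_real,
    Real.norm_of_nonneg (Real.exp_pos _).le]
  have := rpow_le_rpow_add_rpow (w.re - 1) ht hT hT'
  simp only [Complex.sub_re, Complex.one_re]
  gcongr

/-- The bound is independent of `h`, `M` and `im w`, as domination along the vertical contours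
requires. -/
lemma norm_gammaSum_le {h : ℝ} (hh : 0 < h) (h1 : h ≤ 1) (M : ℕ) {w : ℂ} (hw : 0 < w.re) :
    ‖gammaSum h M w‖ ≤ ∫ t in Set.Ioi (0 : ℝ),
      (t ^ (w.re - 1) + (t + 1) ^ (w.re - 1)) * Real.exp (-t) := by
  rw [gammaSum_eq_integral hh]
  refine norm_integral_le_of_norm_le (integrableOn_rpow_add_rpow_mul_exp hw) ?_
  exact (ae_restrict_iff' measurableSet_Ioi).2 (ae_of_all _ fun t ht =>
    norm_gammaStep_le hh h1 M w ht)

lemma measurable_gammaStep (h : ℝ) (M : ℕ) (w : ℂ) : Measurable (gammaStep h M w) := by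
  refine Measurable.indicator ?_ measurableSet_Iic
  have : Measurable fun t : ℝ => ((⌈t / h⌉₊ : ℕ) : ℝ) * h := by
    refine Measurable.mul_const ?_ _
    exact measurable_from_nat.comp (Nat.measurable_ceil.comp (measurable_id.div_const h))
  fun_prop

/-- The integrand may be singular at 0 and the interval grows, so dominated convergence of the step
functions replaces the usual Riemann-sum theorem. -/
lemma tendsto_gammaSum {ι : Type*} {F : Filter ι} [F.IsCountablyGenerated] {h : ι → ℝ}
    {M : ι → ℕ} (hpos : ∀ᶠ i in F, 0 < h i) (h0 : Tendsto h F (𝓝 0))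
    (hM : Tendsto (fun i => M i * h i) F atTop) {w : ℂ} (hw : 0 < w.re) :
    Tendsto (fun i => gammaSum (h i) (M i) w) F (𝓝 (Complex.Gamma w)) := by
  rw [Complex.Gamma_eq_integral hw, Complex.GammaIntegral]
  have h1 : ∀ᶠ i in F, h i ≤ 1 := (h0.eventually (ge_mem_nhds zero_lt_one))
  refine Tendsto.congr' (f₁ := fun i => ∫ t in Set.Ioi (0 : ℝ), gammaStep (h i) (M i) w t) ?_ ?_
  · filter_upwards [hpos] with i hi
    exact (gammaSum_eq_integral hi _ _).symm
  refine tendsto_integral_filter_of_dominated_convergence _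
    (Eventually.of_forall fun i => (measurable_gammaStep _ _ _).aestronglyMeasurable) ?_
    (integrableOn_rpow_add_rpow_mul_exp hw) ?_
  · filter_upwards [hpos, h1] with i hi hi1
    exact (ae_restrict_iff' measurableSet_Ioi).2 (ae_of_all _ fun t ht =>
      norm_gammaStep_le hi hi1 _ w ht)
  · refine (ae_restrict_iff' measurableSet_Ioi).2 (ae_of_all _ fun t ht => ?_)
    have ht : 0 < t := ht
    have hT : Tendsto (fun i => (⌈t / h i⌉₊ * h i : ℝ)) F (𝓝 t) := by
      refine tendsto_of_tendsto_of_tendsto_of_le_of_le' tendsto_const_nhds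
        (by simpa using (tendsto_const_nhds (x := t)).add h0) ?_ ?_
      · filter_upwards [hpos] with i hi using le_ceil_div_mul hi t
      · filter_upwards [hpos] with i hi using ceil_div_mul_le hi ht
    have hc : ContinuousAt (fun T : ℝ => (T : ℂ) ^ (w - 1) * (Real.exp (-T) : ℂ)) t := by
      refine ContinuousAt.mul ?_ (by fun_prop)
      exact Complex.continuousAt_ofReal_cpow_const _ _ (Or.inr ht.ne')
    have := hc.tendsto.comp hT
    rw [mul_comm] at this
    refine this.congr' ?_
    filter_upwards [hM.eventually_ge_atTop t] with i hi
    rw [gammaStep, Set.indicator_of_mem (show t ∈ Set.Iic _ from hi)]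
    rfl

/-! ### Integrals along vertical lines and Cauchy's theorem -/

lemma integrable_vertical_line {f : ℂ → ℂ} {τ α : ℝ} (hα : 0 < α)
    (hf : VerticalDecay f τ τ α) (hc : Continuous fun y : ℝ => f (τ + y * Complex.I)) :
    Integrable fun y : ℝ => f (τ + y * Complex.I) := by
  obtain ⟨K, hK⟩ := hf.exists_le_inv_one_add_sq hα
  refine (integrable_inv_one_add_sq.const_mul K).mono' hc.aestronglyMeasurable
    (ae_of_all _ fun y => ?_)
  simpa using hK (τ + y * Complex.I) (by simp) (by simp)

lemma VerticalDecay.mono {f : ℂ → ℂ} {a b a' b' α : ℝ} (hf : VerticalDecay f a b α)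
    (ha : a ≤ a') (hb : b' ≤ b) : VerticalDecay f a' b' α := by
  obtain ⟨K, n, hK, h⟩ := hf
  exact ⟨K, n, hK, fun z hza hzb => h z (ha.trans hza) (hzb.trans hb)⟩

/-- Shift of the contour of a vertical integral inside a strip of holomorphy and decay. -/
lemma integral_vertical_line_eq {f : ℂ → ℂ} {a b α : ℝ} (hab : a ≤ b) (hα : 0 < α)
    (hf : VerticalDecay f a b α)
    (hd : ∀ z : ℂ, a ≤ z.re → z.re ≤ b → DifferentiableAt ℂ f z) :
    ∫ y : ℝ, f (a + y * Complex.I) = ∫ y : ℝ, f (b + y * Complex.I) := by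
  have hc : ∀ x : ℝ, a ≤ x → x ≤ b → Continuous fun y : ℝ => f (x + y * Complex.I) := by
    intro x hxa hxb
    refine continuous_iff_continuousAt.2 fun y => ?_
    refine ContinuousAt.comp (g := f) (f := fun y : ℝ => (x + y * Complex.I : ℂ)) ?_ (by fun_prop)
    exact (hd _ (by simpa using hxa) (by simpa using hxb)).continuousAt
  have ha := integrable_vertical_line hα (hf.mono le_rfl hab) (hc a le_rfl hab)
  have hb := integrable_vertical_line hα (hf.mono hab le_rfl) (hc b hab le_rfl)
  have ta := intervalIntegral_tendsto_integral ha tendsto_neg_atTop_atBot tendsto_id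
  have tb := intervalIntegral_tendsto_integral hb tendsto_neg_atTop_atBot tendsto_id
  obtain ⟨K, hK⟩ := hf.exists_le_inv_one_add_sq hα
  -- Bound for the two horizontal sides, at heights `T` and `-T`.
  have hz : Tendsto (fun T : ℝ => 2 * (K * (1 + T ^ 2)⁻¹ * |b - a|)) atTop (𝓝 0) := by
    have h1 : Tendsto (fun T : ℝ => (1 + T ^ 2)⁻¹) atTop (𝓝 0) :=
      (tendsto_atTop_add_const_left _ _ (tendsto_pow_atTop two_ne_zero)).inv_tendsto_atTop
    simpa using ((h1.const_mul K).mul_const |b - a|).const_mul 2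
  have hdiff := tb.sub ta
  refine (sub_eq_zero.1 (tendsto_nhds_unique hdiff (squeeze_zero_norm (fun T => ?_) hz))).symm
  have hrect := Complex.integral_boundary_rect_eq_zero_of_differentiableOn f
    ((a : ℂ) + (-T : ℝ) * Complex.I) ((b : ℂ) + T * Complex.I) (by
      intro z hz
      have h1 := hz.1
      simp only [Set.mem_preimage, Complex.add_re, Complex.ofReal_re, Complex.mul_re,
        Complex.I_re, mul_zero, Complex.ofReal_im, Complex.I_im, mul_one, sub_self, add_zero,
        Set.uIcc_of_le hab] at h1
      exact (hd z h1.1 h1.2).differentiableWithinAt)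
  have hhor : ∀ t : ℝ, t ^ 2 = T ^ 2 →
      ‖∫ x in a..b, f (x + t * Complex.I)‖ ≤ K * (1 + T ^ 2)⁻¹ * |b - a| := by
    intro t ht
    refine intervalIntegral.norm_integral_le_of_norm_le_const fun x hx => ?_
    rw [Set.uIoc_of_le hab] at hx
    have := hK (x + t * Complex.I) (by simpa using hx.1.le) (by simpa using hx.2)
    simpa [ht] using this
  have h1 := hhor T rfl
  have h2 := hhor (-T) (by ring)
  simp only [Complex.add_re, Complex.ofReal_re, Complex.mul_re, Complex.I_re, mul_zero,
    Complex.ofReal_im, Complex.I_im, mul_one, sub_self, add_zero, Complex.add_im, Complex.mul_im,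
    zero_add, smul_eq_mul] at hrect
  simp only [id]
  have e : (∫ y in -T..T, f (b + y * Complex.I)) - ∫ y in -T..T, f (a + y * Complex.I) =
      Complex.I * ((∫ x in a..b, f (x + (-T : ℝ) * Complex.I)) -
        ∫ x in a..b, f (x + T * Complex.I)) := by
    have hI := Complex.I_mul_I
    linear_combination (-Complex.I) * hrect + ((∫ y in -T..T, f (b + y * Complex.I)) -
      ∫ y in -T..T, f (a + y * Complex.I)) * hI
  rw [e, norm_mul, Complex.norm_I, one_mul]
  refine (norm_sub_le _ _).trans ?_
  linarith

/-! ### The univariate Fox `H` function -/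

namespace FoxParam

/-- Each index contributes `Γ` or `1/Γ` of an affine function `w + r z` with `r` real of either
sign, so one estimate for each type serves all factors. -/
lemma kernel_eq_prod (P : FoxParam) (z : ℂ) :
    P.kernel z = (∏ l : Fin P.q, if l.val < P.m then Complex.Gamma (P.d l + (-P.D l : ℝ) * z)
        else (Complex.Gamma (1 - P.d l + P.D l * z))⁻¹) *
      ∏ l : Fin P.p, if l.val < P.n then Complex.Gamma (1 - P.c l + P.C l * z)
        else (Complex.Gamma (P.c l + (-P.C l : ℝ) * z))⁻¹ := by
  have e1 : ∀ x y w : ℂ, x - y * w = x + -y * w := fun x y w => by ring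
  simp only [kernel, Finset.prod_ite, Finset.prod_inv_distrib, not_lt, Complex.ofReal_neg, e1]
  rw [div_eq_mul_inv, mul_inv]
  ring

lemma differentiableAt_kernel (P : FoxParam) {z : ℂ} (hz : P.IsContour z.re) :
    DifferentiableAt ℂ P.kernel z := by
  have hG : ∀ (w : ℂ) (r : ℝ), 0 < (w + r * (z.re : ℂ)).re →
      DifferentiableAt ℂ (fun z => Complex.Gamma (w + r * z)) z := by
    intro w r h
    refine DifferentiableAt.comp (g := Complex.Gamma) (f := fun z : ℂ => w + r * z) z ?_ (by fun_prop)
    refine Complex.differentiableAt_Gamma _ fun m hm => ?_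
    have := congrArg Complex.re hm
    have hm0 : (0 : ℝ) ≤ m := m.cast_nonneg
    simp at this h
    linarith
  have hI : ∀ (w : ℂ) (r : ℝ), DifferentiableAt ℂ (fun z => (Complex.Gamma (w + r * z))⁻¹) z :=
    fun w r => DifferentiableAt.comp (g := fun s => (Complex.Gamma s)⁻¹)
      (f := fun z : ℂ => w + r * z) z (Complex.differentiable_one_div_Gamma _) (by fun_prop)
  rw [funext P.kernel_eq_prod]
  refine DifferentiableAt.mul ?_ ?_
  · refine DifferentiableAt.fun_finsetProd fun l _ => ?_
    split_ifs with h
    · exact hG _ _ (by simpa [sub_eq_add_neg] using hz.2 l h)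
    · exact hI _ _
  · refine DifferentiableAt.fun_finsetProd fun l _ => ?_
    split_ifs with h
    · exact hG _ _ (hz.1 l h)
    · exact hI _ _

lemma verticalDecay_Gamma_affine (w : ℂ) (r : ℝ) {a b : ℝ} (ha : 0 < w.re + r * a)
    (hb : 0 < w.re + r * b) :
    VerticalDecay (fun z => Complex.Gamma (w + r * z)) a b (Real.pi / 2 * |r|) := by
  refine (verticalDecay_Gamma (a := min (w.re + r * a) (w.re + r * b))
    (b := max (w.re + r * a) (w.re + r * b)) (lt_min ha hb)).comp_affine w r fun x hxa hxb => ?_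
  rcases le_total 0 r with hr | hr
  · exact ⟨min_le_iff.2 (Or.inl (by gcongr)), le_max_iff.2 (Or.inr (by gcongr))⟩
  · exact ⟨min_le_iff.2 (Or.inr (by nlinarith)), le_max_iff.2 (Or.inl (by nlinarith))⟩

lemma verticalDecay_inv_Gamma_affine (w : ℂ) (r a b : ℝ) :
    VerticalDecay (fun z => (Complex.Gamma (w + r * z))⁻¹) a b (-(Real.pi / 2) * |r|) := by
  refine (verticalDecay_inv_Gamma (min (w.re + r * a) (w.re + r * b))
    (max (w.re + r * a) (w.re + r * b))).comp_affine w r fun x hxa hxb => ?_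
  rcases le_total 0 r with hr | hr
  · exact ⟨min_le_iff.2 (Or.inl (by gcongr)), le_max_iff.2 (Or.inr (by gcongr))⟩
  · exact ⟨min_le_iff.2 (Or.inr (by nlinarith)), le_max_iff.2 (Or.inl (by nlinarith))⟩

/-- A numerator factor of slope `r` adds `π/2 |r|` to the rate and a denominator factor subtracts
it; the total is `π/2` times the excess. -/
lemma verticalDecay_kernel (P : FoxParam) {a b : ℝ} (ha : P.IsContour a) (hb : P.IsContour b) :
    VerticalDecay P.kernel a b (Real.pi / 2 * P.excess) := by
  have h1 : VerticalDecay (fun z => ∏ l : Fin P.q,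
      if l.val < P.m then Complex.Gamma (P.d l + (-P.D l : ℝ) * z)
        else (Complex.Gamma (1 - P.d l + P.D l * z))⁻¹) a b
      (∑ l : Fin P.q, Real.pi / 2 * if l.val < P.m then P.D l else -P.D l) := by
    refine VerticalDecay.prod fun l _ => ?_
    split_ifs with h
    · have := verticalDecay_Gamma_affine (P.d l) (-P.D l) (a := a) (b := b)
        (by simpa [sub_eq_add_neg] using ha.2 l h) (by simpa [sub_eq_add_neg] using hb.2 l h)
      rwa [abs_neg, abs_of_pos (P.D_pos l)] at this
    · have := verticalDecay_inv_Gamma_affine (1 - P.d l) (P.D l) a b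
      rwa [abs_of_pos (P.D_pos l), neg_mul_comm] at this
  have h2 : VerticalDecay (fun z => ∏ l : Fin P.p,
      if l.val < P.n then Complex.Gamma (1 - P.c l + P.C l * z)
        else (Complex.Gamma (P.c l + (-P.C l : ℝ) * z))⁻¹) a b
      (∑ l : Fin P.p, Real.pi / 2 * if l.val < P.n then P.C l else -P.C l) := by
    refine VerticalDecay.prod fun l _ => ?_
    split_ifs with h
    · have := verticalDecay_Gamma_affine (1 - P.c l) (P.C l) (a := a) (b := b)
        (by simpa using ha.1 l h) (by simpa using hb.1 l h)
      rwa [abs_of_pos (P.C_pos l)] at this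
    · have := verticalDecay_inv_Gamma_affine (P.c l) (-P.C l) a b
      rwa [abs_neg, abs_of_pos (P.C_pos l), neg_mul_comm] at this
  have h := h1.mul h2
  rw [← Finset.mul_sum, ← Finset.mul_sum, ← mul_add, add_comm] at h
  rw [funext P.kernel_eq_prod]
  exact h

lemma verticalDecay_cpow {t : ℝ} (ht : 0 < t) (a b : ℝ) :
    VerticalDecay (fun z => (t : ℂ) ^ z) a b 0 := by
  refine ⟨t ^ a + t ^ b, 0, by positivity, fun z ha hb => ?_⟩
  rw [Complex.norm_cpow_eq_rpow_re_of_pos ht]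
  have h1 := Real.rpow_pos_of_pos ht a
  have h2 := Real.rpow_pos_of_pos ht b
  simp only [pow_zero, mul_one, neg_zero, zero_mul, Real.exp_zero]
  rcases le_total 1 t with h | h
  · linarith [Real.rpow_le_rpow_of_exponent_le h hb]
  · linarith [Real.rpow_le_rpow_of_exponent_ge ht h ha]

lemma IsContour.of_mem_Icc {P : FoxParam} {a b x : ℝ} (ha : P.IsContour a) (hb : P.IsContour b)
    (hax : a ≤ x) (hxb : x ≤ b) : P.IsContour x := by
  refine ⟨fun l hl => ?_, fun l hl => ?_⟩
  · have h := ha.1 l hl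
    have := P.C_pos l
    simp at h ⊢
    nlinarith
  · have h := hb.2 l hl
    have := P.D_pos l
    simp at h ⊢
    nlinarith

lemma verticalDecay_kernel_mul_cpow (P : FoxParam) {a b t : ℝ} (ha : P.IsContour a)
    (hb : P.IsContour b) (ht : 0 < t) : VerticalDecay (fun z => P.kernel z * (t : ℂ) ^ z) a b
      (Real.pi / 2 * P.excess) := by
  simpa using (P.verticalDecay_kernel ha hb).mul (verticalDecay_cpow ht a b)

lemma differentiableAt_kernel_mul_cpow (P : FoxParam) {t : ℝ} (ht : 0 < t) {z : ℂ}
    (hz : P.IsContour z.re) :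
    DifferentiableAt ℂ (fun z => P.kernel z * (t : ℂ) ^ z) z :=
  (P.differentiableAt_kernel hz).mul
    (differentiableAt_id.const_cpow (Or.inl (by exact_mod_cast ht.ne')))

lemma integrable_integrand (P : FoxParam) (hP : 0 < P.excess) {τ s : ℝ}
    (hτ : P.IsContour τ) (hs : 0 < s) :
    Integrable fun y : ℝ => P.integrand τ s y := by
  have ht : 0 < P.v * s := mul_pos P.v_pos hs
  refine integrable_vertical_line (f := fun z => P.kernel z * ((P.v * s : ℝ) : ℂ) ^ z)
    (mul_pos (by positivity) hP) (P.verticalDecay_kernel_mul_cpow hτ hτ ht) ?_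
  refine continuous_iff_continuousAt.2 fun y => ?_
  refine ContinuousAt.comp (g := fun z => P.kernel z * ((P.v * s : ℝ) : ℂ) ^ z)
    (f := fun y : ℝ => (τ + y * Complex.I : ℂ)) ?_ (by fun_prop)
  exact (P.differentiableAt_kernel_mul_cpow ht (by simpa using hτ)).continuousAt

lemma foxH_eq_of_le (P : FoxParam) (hP : 0 < P.excess) {σ τ s : ℝ} (hσ : P.IsContour σ)
    (hτ : P.IsContour τ) (hs : 0 < s) (hστ : σ ≤ τ) : P.foxH σ s = P.foxH τ s := by
  have ht : 0 < P.v * s := mul_pos P.v_pos hs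
  rw [foxH, foxH]
  congr 1
  exact integral_vertical_line_eq (f := fun z => P.kernel z * ((P.v * s : ℝ) : ℂ) ^ z) hστ
    (mul_pos (by positivity) hP) (P.verticalDecay_kernel_mul_cpow hσ hτ ht)
    fun z h1 h2 => P.differentiableAt_kernel_mul_cpow ht (hσ.of_mem_Icc hτ h1 h2)

/-- The univariate function does not depend on the contour. -/
lemma foxH_eq (P : FoxParam) (hP : 0 < P.excess) {σ τ s : ℝ} (hσ : P.IsContour σ)
    (hτ : P.IsContour τ) (hs : 0 < s) : P.foxH σ s = P.foxH τ s := by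
  rcases le_total σ τ with h | h
  · exact P.foxH_eq_of_le hP hσ hτ hs h
  · exact (P.foxH_eq_of_le hP hτ hσ hs h).symm

lemma integrand_mul (P : FoxParam) {τ s t : ℝ} (hs : 0 < s) (ht : 0 < t) (y : ℝ) :
    P.integrand τ (t * s) y = P.integrand τ s y * (t : ℂ) ^ ((τ : ℂ) + y * Complex.I) := by
  rw [integrand, integrand, mul_left_comm, mul_comm t, Complex.ofReal_mul,
    Complex.mul_cpow_ofReal_nonneg (mul_pos P.v_pos hs).le ht.le, mul_assoc]

end FoxParam

/-! ### The multivariate function and its discretization -/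

namespace OuterParam

variable {N : ℕ}

lemma special_kernel (η : ℝ) (ζ : Fin N → ℂ) :
    (special N η).kernel ζ = Complex.Gamma (η + ∑ j, ζ j) := by
  simp only [kernel, special]
  simp
  change _ ^ 1 / 1 = _
  simp

lemma special_isContour_iff {η : ℝ} {P : Fin N → FoxParam} {τ : Fin N → ℝ} :
    (special N η).IsContour P τ ↔ (∀ j, (P j).IsContour (τ j)) ∧ 0 < η + ∑ j, τ j := by
  simp [IsContour, special]

/-- All lines can be put at `-δ` with `δ > 0` small: the strict conditions survive a small shift,
while `re d ≥ 0` becomes strict by gaining `D δ`. -/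
lemma exists_special_isContour {η : ℝ} (hη : 0 < η) {P : Fin N → FoxParam}
    (hP : ∀ j, (P j).HasMGFPoles) : ∃ τ : Fin N → ℝ, (special N η).IsContour P τ := by
  have hev : ∀ᶠ δ : ℝ in 𝓝[>] 0, (∀ j, (P j).IsContour (-δ)) ∧ 0 < η + ∑ _j : Fin N, -δ := by
    refine (eventually_all.2 fun j => ?_).and ?_
    · refine (eventually_all.2 fun l => ?_).and (eventually_all.2 fun l => ?_)
      · by_cases hl : l.val < (P j).n
        · have h : 0 < 1 - ((P j).c l).re - (P j).C l * 0 := by linarith [(hP j).1 l hl]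
          have hc : Continuous fun δ : ℝ => 1 - ((P j).c l).re - (P j).C l * δ := by fun_prop
          filter_upwards [nhdsWithin_le_nhds (hc.continuousAt.eventually (lt_mem_nhds h))]
            with δ hδ _
          simpa [sub_eq_add_neg] using hδ
        · exact Eventually.of_forall fun _ h => absurd h hl
      · filter_upwards [self_mem_nhdsWithin] with δ hδ hl
        have h1 := (hP j).2 l hl
        have h2 : 0 < (P j).D l * δ := mul_pos ((P j).D_pos l) hδ
        simp
        linarith
    · have hc : Continuous fun δ : ℝ => η + ∑ _j : Fin N, -δ := by fun_prop
      exact nhdsWithin_le_nhds (hc.continuousAt.eventually (lt_mem_nhds (by simpa using hη)))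
  obtain ⟨δ, hδ⟩ := hev.exists
  exact ⟨fun _ => -δ, special_isContour_iff.2 hδ⟩

lemma norm_Gamma_le_Gamma_re {z : ℂ} (hz : 0 < z.re) : ‖Complex.Gamma z‖ ≤ Real.Gamma z.re := by
  rw [Complex.Gamma_eq_integral hz, Complex.GammaIntegral, Real.Gamma_eq_integral hz]
  refine norm_integral_le_of_norm_le (Real.GammaIntegral_convergent hz) ?_
  refine (ae_restrict_iff' measurableSet_Ioi).2 (ae_of_all _ fun t ht => ?_)
  rw [norm_mul, Complex.norm_cpow_eq_rpow_re_of_pos ht, Complex.norm_real,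
    Real.norm_of_nonneg (Real.exp_pos _).le]
  simp

/-- The argument `η + ∑ ζ_j` of the coupling Gamma factor at `ζ_j = τ_j + i y_j`. -/
def couplingArg (η : ℝ) (τ y : Fin N → ℝ) : ℂ := η + ∑ j, ((τ j : ℂ) + y j * Complex.I)

lemma couplingArg_re (η : ℝ) (τ y : Fin N → ℝ) : (couplingArg η τ y).re = η + ∑ j, τ j := by
  simp [couplingArg]

lemma continuous_couplingArg (η : ℝ) (τ : Fin N → ℝ) : Continuous (couplingArg η τ) := by
  unfold couplingArg
  fun_prop

lemma special_integrand (η : ℝ) (P : Fin N → FoxParam) (τ s y : Fin N → ℝ) :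
    (special N η).integrand P τ s y = (∏ j, (P j).integrand (τ j) (s j) (y j)) *
      Complex.Gamma (couplingArg η τ y) := by
  rw [integrand, special_kernel, mul_comm]
  rfl

lemma integrable_special_integrand {η : ℝ} {P : Fin N → FoxParam} (hP : ∀ j, 0 < (P j).excess)
    {τ s : Fin N → ℝ} (hτ : (special N η).IsContour P τ) (hs : ∀ j, 0 < s j) :
    Integrable fun y => (special N η).integrand P τ s y := by
  rw [special_isContour_iff] at hτ
  have hre : ∀ y, 0 < (couplingArg η τ y).re := fun y => by rw [couplingArg_re]; exact hτ.2
  simp only [special_integrand]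
  refine (Integrable.fintype_prod fun j =>
    (P j).integrable_integrand (hP j) (hτ.1 j) (hs j)).mul_bdd (c := Real.Gamma (η + ∑ j, τ j))
    ?_ (ae_of_all _ fun y => ?_)
  · refine Continuous.aestronglyMeasurable (continuous_iff_continuousAt.2 fun y => ?_)
    refine ContinuousAt.comp (g := Complex.Gamma) (f := couplingArg η τ) ?_
      (continuous_couplingArg η τ).continuousAt
    refine (Complex.differentiableAt_Gamma _ fun m hm => ?_).continuousAt
    have h1 := congrArg Complex.re hm
    have h2 := hre y
    have hm0 : (0 : ℝ) ≤ m := m.cast_nonneg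
    simp only [Complex.neg_re, Complex.natCast_re] at h1
    linarith
  · rw [← couplingArg_re η τ y]
    exact norm_Gamma_le_Gamma_re (hre y)

lemma continuous_gammaSum {h : ℝ} (hh : 0 < h) (M : ℕ) : Continuous (gammaSum h M) := by
  unfold gammaSum
  refine continuous_finsetSum _ fun l hl => ?_
  have hl1 : 0 < (l : ℝ) := by exact_mod_cast (Finset.mem_Icc.1 hl).1
  have h0 : ((l * h : ℝ) : ℂ) ≠ 0 := by exact_mod_cast (mul_pos hl1 hh).ne'
  refine continuous_const.mul (Continuous.mul ?_ continuous_const)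
  exact (continuous_id.sub continuous_const).const_cpow (Or.inl h0)

lemma integrable_prod_integrand_mul_cpow {η : ℝ} {P : Fin N → FoxParam}
    (hP : ∀ j, 0 < (P j).excess) {τ s : Fin N → ℝ} (hτ : ∀ j, (P j).IsContour (τ j))
    (hs : ∀ j, 0 < s j) {h : ℝ} (hh : 0 < h) (l : ℕ) (hl : 0 < l) :
    Integrable fun y : Fin N → ℝ => (∏ j, (P j).integrand (τ j) (s j) (y j)) *
      ((l * h : ℝ) : ℂ) ^ (couplingArg η τ y - 1) := by
  have hlh : 0 < l * h := mul_pos (by exact_mod_cast hl) hh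
  refine (Integrable.fintype_prod fun j =>
    (P j).integrable_integrand (hP j) (hτ j) (hs j)).mul_bdd
    (c := (l * h) ^ (η + ∑ j, τ j - 1)) ?_ (ae_of_all _ fun y => ?_)
  · refine Continuous.aestronglyMeasurable ?_
    exact ((continuous_couplingArg η τ).sub continuous_const).const_cpow
      (Or.inl (by exact_mod_cast hlh.ne'))
  · rw [Complex.norm_cpow_eq_rpow_re_of_pos hlh, Complex.sub_re, couplingArg_re, Complex.one_re]

lemma prod_cpow {ι : Type*} (s : Finset ι) (f : ι → ℂ) {t : ℂ} (ht : t ≠ 0) :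
    ∏ i ∈ s, t ^ f i = t ^ ∑ i ∈ s, f i := by
  simp only [Complex.cpow_def_of_ne_zero ht, Finset.mul_sum, Complex.exp_sum]

/-- Scaling an argument by `t` multiplies its integrand by `t ^ ζ_j`. After Fubini these factors and
`t ^ (η - 1)` combine into the integrand power of Euler's integral. -/
lemma prod_foxH_mul {P : Fin N → FoxParam} {τ s : Fin N → ℝ} (hs : ∀ j, 0 < s j) {t : ℝ}
    (ht : 0 < t) (η : ℝ) :
    ((t ^ (η - 1) : ℝ) : ℂ) * ∏ j, (P j).foxH (τ j) (t * s j) =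
      (∏ j, (P j).u) / (2 * Real.pi) ^ N * ∫ y : Fin N → ℝ,
        (∏ j, (P j).integrand (τ j) (s j) (y j)) * (t : ℂ) ^ (couplingArg η τ y - 1) := by
  have ht0 : (t : ℂ) ≠ 0 := by exact_mod_cast ht.ne'
  simp only [FoxParam.foxH, Finset.prod_mul_distrib, Finset.prod_div_distrib, Finset.prod_const,
    Finset.card_univ, Fintype.card_fin]
  rw [mul_left_comm, ← integral_fintype_prod_eq_prod]
  congr 1
  · rw [mul_pow]
  rw [← integral_const_mul]
  refine integral_congr_ae (ae_of_all _ fun y => ?_)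
  simp only
  rw [Finset.prod_congr rfl fun j _ => (P j).integrand_mul (hs j) ht (y j),
    Finset.prod_mul_distrib, mul_left_comm]
  congr 1
  rw [prod_cpow _ _ ht0, Complex.ofReal_cpow ht.le, ← Complex.cpow_add _ _ ht0]
  congr 1
  simp only [couplingArg]
  push_cast
  ring

/-- The finite sum of products of univariate functions as one multivariate integral with the
coupling Gamma factor replaced by its Riemann sum. -/
lemma sum_prod_foxH_eq_integral {P : Fin N → FoxParam} (hP : ∀ j, 0 < (P j).excess)
    {τ s : Fin N → ℝ} (hτ : ∀ j, (P j).IsContour (τ j)) (hs : ∀ j, 0 < s j) (η : ℝ) {h : ℝ}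
    (hh : 0 < h) (M : ℕ) :
    ∑ l ∈ Finset.Icc 1 M, (h : ℂ) * (Real.exp (-(l * h)) : ℂ) *
        ((((l * h) ^ (η - 1) : ℝ) : ℂ) * ∏ j, (P j).foxH (τ j) (l * h * s j)) =
      (∏ j, (P j).u) / (2 * Real.pi) ^ N * ∫ y : Fin N → ℝ,
        (∏ j, (P j).integrand (τ j) (s j) (y j)) * gammaSum h M (couplingArg η τ y) := by
  have hl1 : ∀ l ∈ Finset.Icc 1 M, 0 < l := fun l hl => (Finset.mem_Icc.1 hl).1
  have e : ∀ y : Fin N → ℝ, (∏ j, (P j).integrand (τ j) (s j) (y j)) *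
      gammaSum h M (couplingArg η τ y) = ∑ l ∈ Finset.Icc 1 M,
        ((h : ℂ) * (Real.exp (-(l * h)) : ℂ)) * ((∏ j, (P j).integrand (τ j) (s j) (y j)) *
          ((l * h : ℝ) : ℂ) ^ (couplingArg η τ y - 1)) := by
    intro y
    rw [gammaSum, Finset.mul_sum]
    exact Finset.sum_congr rfl fun l _ => by ring
  simp only [e]
  rw [integral_finsetSum _ fun l hl =>
    (integrable_prod_integrand_mul_cpow hP hτ hs hh l (hl1 l hl)).const_mul _, Finset.mul_sum]
  refine Finset.sum_congr rfl fun l hl => ?_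
  have hl0 : (0 : ℝ) < l := by exact_mod_cast hl1 l hl
  rw [prod_foxH_mul hs (mul_pos hl0 hh), integral_const_mul]
  ring

lemma tendsto_sum_prod_foxH {ι : Type*} {F : Filter ι} [F.IsCountablyGenerated] {h : ι → ℝ}
    {M : ι → ℕ} (hpos : ∀ᶠ i in F, 0 < h i) (h0 : Tendsto h F (𝓝 0))
    (hM : Tendsto (fun i => M i * h i) F atTop) {η : ℝ} {P : Fin N → FoxParam}
    (hP : ∀ j, 0 < (P j).excess) {τ s : Fin N → ℝ} (hτ : (special N η).IsContour P τ)
    (hs : ∀ j, 0 < s j) :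
    Tendsto (fun i => ∑ l ∈ Finset.Icc 1 (M i), (h i : ℂ) * (Real.exp (-(l * h i)) : ℂ) *
        ((((l * h i) ^ (η - 1) : ℝ) : ℂ) * ∏ j, (P j).foxH (τ j) (l * h i * s j)))
      F (𝓝 ((special N η).foxH P τ s)) := by
  rw [special_isContour_iff] at hτ
  have hre : ∀ y, 0 < (couplingArg η τ y).re := fun y => by rw [couplingArg_re]; exact hτ.2
  have hint : Integrable fun y : Fin N → ℝ => ∏ j, (P j).integrand (τ j) (s j) (y j) :=
    Integrable.fintype_prod fun j => (P j).integrable_integrand (hP j) (hτ.1 j) (hs j)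
  have h1 : ∀ᶠ i in F, h i ≤ 1 := h0.eventually (ge_mem_nhds zero_lt_one)
  refine Tendsto.congr' (f₁ := fun i => (∏ j, (P j).u) / (2 * Real.pi) ^ N * ∫ y : Fin N → ℝ,
    (∏ j, (P j).integrand (τ j) (s j) (y j)) * gammaSum (h i) (M i) (couplingArg η τ y)) ?_ ?_
  · filter_upwards [hpos] with i hi
    exact (sum_prod_foxH_eq_integral hP hτ.1 hs η hi (M i)).symm
  simp only [foxH, special_integrand]
  refine Tendsto.const_mul _ (tendsto_integral_filter_of_dominated_convergence
    (fun y => ‖∏ j, (P j).integrand (τ j) (s j) (y j)‖ * ∫ t in Set.Ioi (0 : ℝ),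
      (t ^ (η + ∑ j, τ j - 1) + (t + 1) ^ (η + ∑ j, τ j - 1)) * Real.exp (-t)) ?_ ?_
    (hint.norm.mul_const _) ?_)
  · filter_upwards [hpos] with i hi
    exact hint.aestronglyMeasurable.mul
      ((continuous_gammaSum hi _).comp (continuous_couplingArg η τ)).aestronglyMeasurable
  · filter_upwards [hpos, h1] with i hi hi1
    refine ae_of_all _ fun y => ?_
    rw [norm_mul, ← couplingArg_re η τ y]
    exact mul_le_mul_of_nonneg_left (norm_gammaSum_le hi hi1 _ (hre y)) (norm_nonneg _)
  · exact ae_of_all _ fun y => (tendsto_gammaSum hpos h0 hM (hre y)).const_mul _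

end OuterParam

/-! ### The approximation theorem -/

theorem theorem3 (N : ℕ) (hN : 0 < N) (P : Fin N → FoxParam) (ρ η : ℝ) (hρ : 0 < ρ) (hη : 0 ≤ η)
    (hP : ∀ j, 0 < (P j).excess) :
    -- suitable contours for the multivariate function exist
    ((0 < η ∧ ∀ j, (P j).HasMGFPoles) →
      ∃ τ : Fin N → ℝ, (OuterParam.special N η).IsContour P τ) ∧
    -- the univariate functions converge absolutely, along every suitable contour
    (∀ (j : Fin N) (σ : ℝ), (P j).IsContour σ → ∀ s : ℝ, 0 < s →
      Integrable (fun y : ℝ => (P j).integrand σ s y)) ∧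
    -- whatever the suitable contours `τ` and `σ` of the multivariate and univariate functions
    ∀ τ : Fin N → ℝ, (OuterParam.special N η).IsContour P τ →
      Integrable (fun y : Fin N → ℝ =>
        (OuterParam.special N η).integrand P τ (fun _ => ρ / N) y) ∧
      ∀ σ : Fin N → ℝ, (∀ j, (P j).IsContour (σ j)) →
        ∀ ε : ℝ, 0 < ε → ∃ K : ℝ, 0 < K ∧ ∀ (Q : ℝ) (M : ℕ), K ≤ Q → K * Q ≤ M →
          ‖(OuterParam.special N η).foxH P τ (fun _ => ρ / N) -
            (((Q / M) ^ η : ℝ) : ℂ) *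
              ∑ l ∈ Finset.Icc 1 M,
                (((l : ℝ) ^ (η - 1) * Real.exp (-(l * Q / M)) : ℝ) : ℂ) *
                  ∏ j, (P j).foxH (σ j) (l * Q * ρ / (M * N))‖ < ε := by
  have hN' : (0 : ℝ) < N := by exact_mod_cast hN
  have hs : ∀ _j : Fin N, 0 < ρ / N := fun _ => div_pos hρ hN'
  refine ⟨fun h => OuterParam.exists_special_isContour h.1 h.2,
    fun j σ hσ s hs => (P j).integrable_integrand (hP j) hσ hs, fun τ hτ =>
    ⟨OuterParam.integrable_special_integrand hP hτ hs, fun σ hσ ε hε => ?_⟩⟩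
  -- The regime `0 ≪ Q ≪ M` is the pullback of `atTop` along `min Q (M/Q)`; it is countably
  -- generated, so dominated convergence applies.
  let m : ℝ × ℕ → ℝ := fun i => min i.1 (i.2 / i.1)
  have hm : Tendsto m (comap m atTop) atTop := tendsto_comap
  have hQ : Tendsto (fun i : ℝ × ℕ => i.1) (comap m atTop) atTop :=
    tendsto_atTop_mono (fun i => min_le_left _ _) hm
  have hMQ : Tendsto (fun i : ℝ × ℕ => (i.2 : ℝ) / i.1) (comap m atTop) atTop :=
    tendsto_atTop_mono (fun i => min_le_right _ _) hm
  have hpos : ∀ᶠ i in comap m atTop, 0 < i.1 / (i.2 : ℝ) := by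
    filter_upwards [hMQ.eventually_gt_atTop 0] with i hi
    rw [← inv_div]; exact inv_pos.2 hi
  have h0 : Tendsto (fun i : ℝ × ℕ => i.1 / (i.2 : ℝ)) (comap m atTop) (𝓝 0) := by
    refine hMQ.inv_tendsto_atTop.congr fun i => ?_
    simp
  have hMh : Tendsto (fun i : ℝ × ℕ => (i.2 : ℝ) * (i.1 / (i.2 : ℝ))) (comap m atTop) atTop := by
    refine hQ.congr' ?_
    filter_upwards [hpos] with i hi
    have : (i.2 : ℝ) ≠ 0 := by rintro h; simp [h] at hi
    field_simp
  have hlim := OuterParam.tendsto_sum_prod_foxH hpos h0 hMh hP hτ hs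
  obtain ⟨S, hS, hSK⟩ := eventually_comap.1 (Metric.tendsto_nhds.1 hlim ε hε) |>.exists_mem
  obtain ⟨K, hK⟩ := mem_atTop_sets.1 hS
  -- The 1 forces `Q` and `M` to be positive even if `K` is not.
  refine ⟨max K 1, by positivity, fun Q M hKQ hKM => ?_⟩
  have hQ0 : 0 < Q := lt_of_lt_of_le (by positivity) hKQ
  have hM0 : (0 : ℝ) < M := lt_of_lt_of_le (by positivity) hKM
  have hdist := hSK _ (hK (m (Q, M)) (le_min ((le_max_left _ _).trans hKQ)
    ((le_max_left _ _).trans ((le_div_iff₀ hQ0).2 hKM)))) (Q, M) rfl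
  rw [dist_comm, dist_eq_norm] at hdist
  refine lt_of_eq_of_lt (congrArg (fun w =>
    ‖(OuterParam.special N η).foxH P τ (fun _ => ρ / N) - w‖) ?_) hdist
  rw [Finset.mul_sum]
  refine Finset.sum_congr rfl fun l hl => ?_
  have hl0 : (0 : ℝ) < l := by exact_mod_cast (Finset.mem_Icc.1 hl).1
  have hh : 0 < Q / M := div_pos hQ0 hM0
  have hfox : ∀ j, (P j).foxH (σ j) (l * Q * ρ / (M * N)) =
      (P j).foxH (τ j) (l * (Q / M) * (ρ / N)) := by
    intro j
    rw [show l * Q * ρ / (M * N) = l * (Q / M) * (ρ / N) by field_simp]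
    exact (P j).foxH_eq (hP j) (hσ j) (hτ.1 j) (by positivity)
  simp only [hfox]
  -- One factor `Q/M` of `(Q/M) ^ η` is the mesh of the Riemann sum; the rest belongs to the node
  -- power `(l Q/M) ^ (η - 1)`.
  rw [← mul_assoc, ← mul_assoc, mul_div_assoc, Real.mul_rpow hl0.le hh.le,
    show (Q / M : ℝ) ^ η = Q / M * (Q / M) ^ (η - 1) by
      rw [Real.rpow_sub_one hh.ne', mul_div_cancel₀ _ hh.ne']]
  congr 1
  push_cast
  ring
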